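/- Let $A$ be a finite set. A finite monoid is aperiodic if all its subgroups (subsemigroups that are groups) are trivial. Let $\overline{\Omega}_A\mathsf{A}$ be the free pro-aperiodic monoid on $A$, i.e. the inverse limit of the $A$-generated finite aperiodic monoids (discrete) with its natural compact topology; for $x\in\overline{\Omega}_A\mathsf{A}$ let $x^\omega$ be the unique idempotent in the closed subsemigroup generated by $x$. The $\omega$-terms over $A$ are the formal terms built from the letters of $A$ and the constant $1$ by the binary operation $\cdot$ and the unary operation $(\ )^\omega$; no identities (not even associativity) are imposed on terms. An $\omega$-term represents $w\in\overline{\Omega}_A\mathsf{A}$ if its natural value in $\overline{\Omega}_A\mathsf{A}$ is $w$. An $\omega$-word is an element of the subset of $\overline{\Omega}_A\mathsf{A}$ generated by $A$ under $1$, multiplication and the $\omega$-power. For an $\omega$-term $s$ put $s^1=s$ and $s^{k+1}=s^k\cdot s$, and let $s^0\cdot t$ and $t\cdot s^0$ both denote $t$. The decompositions of an $\omega$-term $t$ are the pairs of $\omega$-terms defined inductively as follows. - If $t$ is $1$ or a letter, they are $(1,t)$ and $(t,1)$. - If $t=t_1\cdot t_2$, they are the pairs $(s_1,s_2\cdot t_2)$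 with $(s_1,s_2)$ a decomposition of $t_1$, and the pairs $(t_1\cdot s_1,s_2)$ with $(s_1,s_2)$ a decomposition of $t_2$. - If $t=s^\omega$, they are the pairs $(s^k\cdot s_1,\,s_2\cdot s^\ell)$ with $(s_1,s_2)$ a decomposition of $s$ and $k,\ell\in\{0,1,2,\dots\}\cup\{\omega\}$, at least one of $k,\ell$ being $\omega$. **Theorem.** Let $t$ be an $\omega$-term and $u,v\in\overline{\Omega}_A\mathsf{A}$. Then $t$ represents $uv$ if and only if there is a decomposition $(t_1,t_2)$ of $t$ such that $t_1$ represents $u$ and $t_2$ represents $v$. Consequently, every $\omega$-word $w$ is represented by some $\omega$-term, and for every $\omega$-term $t$ representing $w$ and every factorization $w=uv$ with $u,v\in\overline{\Omega}_A\mathsf{A}$ there is a decomposition $(t_1,t_2)$ of $t$ such that $t_1$ represents $u$ and $t_2$ represents $v$. -/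

import Mathlib

/-- `S` is a group under the multiplication of `M`; its identity need not be that of `M`. -/
def IsGroupIn {M : Type*} [Monoid M] (S : Subsemigroup M) : Prop :=
  ∃ e ∈ S, (∀ x ∈ S, e * x = x ∧ x * e = x) ∧ ∀ x ∈ S, ∃ y ∈ S, x * y = e ∧ y * x = e

/-- All subgroups of the monoid `M` are trivial. -/
def IsAperiodicMonoid (M : Type*) [Monoid M] : Prop :=
  ∀ S : Subsemigroup M, IsGroupIn S → (S : Set M).Subsingleton

/-- Indices of the projective system of `A`-generated finite aperiodic monoids: up to isomorphism,
such a monoid is the quotient of the free monoid by a unique congruence. -/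
def AperiodicCon (A : Type*) : Type _ :=
  {c : Con (FreeMonoid A) // Finite c.Quotient ∧ IsAperiodicMonoid c.Quotient}

/-- The `A`-generated finite aperiodic monoid with index `c`, as a discrete space. -/
def AperiodicCon.Level {A : Type*} (c : AperiodicCon A) : Type _ := c.1.Quotient

namespace AperiodicCon

variable {A : Type*} (c : AperiodicCon A)

instance : Monoid c.Level := inferInstanceAs (Monoid c.1.Quotient)

instance : Finite c.Level := c.2.1

instance : TopologicalSpace c.Level := ⊥

instance : DiscreteTopology c.Level := ⟨rfl⟩

/-- The quotient map from the free monoid. -/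
def proj : FreeMonoid A →* c.Level := c.1.mk'

/-- The natural homomorphism from the finer quotient to the coarser one. -/
def transition {c d : AperiodicCon A} (h : c.1 ≤ d.1) : c.Level →* d.Level := Con.map c.1 d.1 h

end AperiodicCon

/-- The compatible families in the product of all `A`-generated finite aperiodic monoids. -/
def compatibleFamilies (A : Type*) : Submonoid (∀ c : AperiodicCon A, c.Level) where
  carrier := {x | ∀ (c d : AperiodicCon A) (h : c.1 ≤ d.1), AperiodicCon.transition h (x c) = x d}
  one_mem' := fun c d h => map_one (AperiodicCon.transition h)
  mul_mem' := by
    intro x y hx hy c d h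
    rw [Pi.mul_apply, Pi.mul_apply, map_mul, hx c d h, hy c d h]

/-- The free pro-aperiodic monoid on `A`: the inverse limit of the `A`-generated finite aperiodic
monoids, with the topology induced by the product of the discrete topologies. -/
def FreeProAperiodic (A : Type*) : Type _ := ↥(compatibleFamilies A)

namespace FreeProAperiodic

variable {A : Type*}

instance : Monoid (FreeProAperiodic A) := inferInstanceAs (Monoid (compatibleFamilies A))

instance : TopologicalSpace (FreeProAperiodic A) :=
  inferInstanceAs (TopologicalSpace (compatibleFamilies A))

instance : ContinuousMul (FreeProAperiodic A) :=
  inferInstanceAs (ContinuousMul (compatibleFamilies A))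

instance : T2Space (FreeProAperiodic A) := inferInstanceAs (T2Space (compatibleFamilies A))

instance : CompactSpace (FreeProAperiodic A) := by
  have hc : IsClosed (compatibleFamilies A : Set (∀ c : AperiodicCon A, c.Level)) := by
    have : (compatibleFamilies A : Set (∀ c : AperiodicCon A, c.Level)) =
        ⋂ (c : AperiodicCon A) (d : AperiodicCon A) (h : c.1 ≤ d.1),
          {x | AperiodicCon.transition h (x c) = x d} := by
      ext x
      simp only [Set.mem_iInter]
      rfl
    rw [this]
    exact isClosed_iInter fun c => isClosed_iInter fun d => isClosed_iInter fun h =>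
      isClosed_eq (continuous_of_discreteTopology.comp (continuous_apply c)) (continuous_apply d)
  exact isCompact_iff_compactSpace.mp hc.isCompact

/-- The canonical generator given by a letter. -/
def ofLetter (a : A) : FreeProAperiodic A :=
  ⟨fun c => c.proj (FreeMonoid.of a), fun _ _ _ => rfl⟩

/-- The coordinate of a pseudoword at an `A`-generated finite aperiodic monoid. -/
def coord (c : AperiodicCon A) : FreeProAperiodic A →* c.Level :=
  (Pi.evalMonoidHom _ c).comp (compatibleFamilies A).subtype

theorem continuous_coord (c : AperiodicCon A) : Continuous (coord c) :=
  (continuous_apply c).comp continuous_subtype_val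

theorem ext_coord {x y : FreeProAperiodic A} (h : ∀ c, coord c x = coord c y) : x = y :=
  Subtype.ext (funext h)

/-- The closed subsemigroup generated by `x`. -/
def closedPowers (x : FreeProAperiodic A) : Subsemigroup (FreeProAperiodic A) :=
  (Subsemigroup.closure {x}).topologicalClosure

theorem coord_mem_powers {x e : FreeProAperiodic A} (he : e ∈ closedPowers x)
    (c : AperiodicCon A) : ∃ n : ℕ, 0 < n ∧ coord c e = coord c x ^ n := by
  have hcl : IsClosed {e | ∃ n : ℕ, 0 < n ∧ coord c e = coord c x ^ n} :=
    (isClosed_discrete {y : c.Level | ∃ n : ℕ, 0 < n ∧ y = coord c x ^ n}).preimage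
      (continuous_coord c)
  refine closure_minimal ?_ hcl he
  intro y hy
  refine Subsemigroup.closure_induction (p := fun y _ => ∃ n : ℕ, 0 < n ∧ coord c y = coord c x ^ n)
    ?_ ?_ hy
  · intro z hz
    rw [Set.mem_singleton_iff] at hz
    exact ⟨1, one_pos, by rw [hz, pow_one]⟩
  · rintro z w _ _ ⟨m, hm, hz⟩ ⟨n, hn, hw⟩
    exact ⟨m + n, by omega, by rw [map_mul, hz, hw, pow_add]⟩

theorem self_mem_closedPowers (x : FreeProAperiodic A) : x ∈ closedPowers x :=
  Subsemigroup.le_topologicalClosure _ (Subsemigroup.subset_closure (Set.mem_singleton x))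

theorem pow_eq_of_mul_self {M : Type*} [Monoid M] {a : M} (h : a * a = a) {n : ℕ} (hn : 0 < n) :
    a ^ n = a := by
  induction n, hn using Nat.le_induction with
  | base => exact pow_one a
  | succ k _ ih => rw [pow_succ, ih, h]

theorem existsUnique_idempotent (x : FreeProAperiodic A) :
    ∃! e, e ∈ closedPowers x ∧ e * e = e := by
  obtain ⟨e, he, hee⟩ := exists_idempotent_in_compact_subsemigroup
    (fun r : FreeProAperiodic A => continuous_mul_const r)
    (closedPowers x : Set (FreeProAperiodic A)) ⟨x, self_mem_closedPowers x⟩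
    (Subsemigroup.isClosed_topologicalClosure _).isCompact
    (fun a ha b hb => (closedPowers x).mul_mem ha hb)
  refine ⟨e, ⟨he, hee⟩, ?_⟩
  rintro f ⟨hf, hff⟩
  refine ext_coord fun c => ?_
  obtain ⟨m, hm, h1⟩ := coord_mem_powers he c
  obtain ⟨n, hn, h2⟩ := coord_mem_powers hf c
  have e1 : coord c e * coord c e = coord c e := by rw [← map_mul, hee]
  have f1 : coord c f * coord c f = coord c f := by rw [← map_mul, hff]
  rw [← pow_eq_of_mul_self e1 hn, ← pow_eq_of_mul_self f1 hm, h1, h2, ← pow_mul, ← pow_mul,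
    mul_comm]

/-- The `ω`-power of `x`: the unique idempotent in the closed subsemigroup generated by `x`. -/
noncomputable def omegaPow (x : FreeProAperiodic A) : FreeProAperiodic A :=
  (existsUnique_idempotent x).choose

/-- The `ω`-words: the subalgebra generated by the letters for the operations `1`, `·`, `ω`. -/
inductive IsOmegaWord : FreeProAperiodic A → Prop
  | letter (a : A) : IsOmegaWord (ofLetter a)
  | one : IsOmegaWord 1
  | mul {x y : FreeProAperiodic A} : IsOmegaWord x → IsOmegaWord y → IsOmegaWord (x * y)
  | omega {x : FreeProAperiodic A} : IsOmegaWord x → IsOmegaWord (omegaPow x)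

end FreeProAperiodic

/-- The absolutely free algebra of `ω`-terms over `A`. -/
inductive OmegaTerm (A : Type*) : Type _
  | one : OmegaTerm A
  | letter (a : A) : OmegaTerm A
  | mul (s t : OmegaTerm A) : OmegaTerm A
  | omega (s : OmegaTerm A) : OmegaTerm A

/-- A non-negative integer or `ω`. -/
inductive OmegaExponent : Type
  | nat (n : ℕ) : OmegaExponent
  | omega : OmegaExponent

namespace OmegaTerm

variable {A : Type*}

/-- The natural homomorphism from `ω`-terms to the free pro-aperiodic monoid. -/
noncomputable def eval : OmegaTerm A → FreeProAperiodic A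
  | one => 1
  | letter a => FreeProAperiodic.ofLetter a
  | mul s t => s.eval * t.eval
  | omega s => FreeProAperiodic.omegaPow s.eval

/-- The term `t` represents the pseudoword `w`. -/
def Represents (t : OmegaTerm A) (w : FreeProAperiodic A) : Prop := t.eval = w

/-- `powSucc s n` is the term `s ^ (n + 1)`, where `s ^ 1 = s` and `s ^ (k + 1) = s ^ k · s`. -/
def powSucc (s : OmegaTerm A) : ℕ → OmegaTerm A
  | 0 => s
  | n + 1 => mul (powSucc s n) s

/-- The term `s ^ k · t`, where `s ^ 0 · t` is `t` itself. -/
def powMul (s : OmegaTerm A) (k : OmegaExponent) (t : OmegaTerm A) : OmegaTerm A :=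
  match k with
  | .nat 0 => t
  | .nat (n + 1) => mul (powSucc s n) t
  | .omega => mul (omega s) t

/-- The term `t · s ^ l`, where `t · s ^ 0` is `t` itself. -/
def mulPow (t s : OmegaTerm A) (l : OmegaExponent) : OmegaTerm A :=
  match l with
  | .nat 0 => t
  | .nat (n + 1) => mul t (powSucc s n)
  | .omega => mul t (omega s)

/-- `IsDecomposition t t₁ t₂`: the pair `(t₁, t₂)` is a decomposition of the term `t`. -/
inductive IsDecomposition : OmegaTerm A → OmegaTerm A → OmegaTerm A → Prop
  | one : IsDecomposition one one one
  | letter_right (a : A) : IsDecomposition (letter a) one (letter a)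
  | letter_left (a : A) : IsDecomposition (letter a) (letter a) one
  | mul_left {t₁ t₂ s₁ s₂ : OmegaTerm A} :
      IsDecomposition t₁ s₁ s₂ → IsDecomposition (mul t₁ t₂) s₁ (mul s₂ t₂)
  | mul_right {t₁ t₂ s₁ s₂ : OmegaTerm A} :
      IsDecomposition t₂ s₁ s₂ → IsDecomposition (mul t₁ t₂) (mul t₁ s₁) s₂
  | omega {s s₁ s₂ : OmegaTerm A} (k l : OmegaExponent) :
      (k = OmegaExponent.omega ∨ l = OmegaExponent.omega) → IsDecomposition s s₁ s₂ →
      IsDecomposition (omega s) (powMul s k s₁) (mulPow s₂ s l)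

end OmegaTerm

/-! A decomposition multiplies back to its term because `x ^ ω` absorbs powers of `x` on either
side. The converse rests on multiplication being open: if words approximate `u * v` finely enough,
they can be cut into words approximating `u` and `v`. For a level `c`, call two words equivalent
when their factorizations have the same pairs of images in `c`. This is a congruence with finite
aperiodic quotient (`factorCon`), so agreement there lets a cut be transported from one word to
another (`exists_factorization`).

Factorizations of pseudowords thus reduce to cuts of words, followed by a limit along an
ultrafilter, which exists by compactness. A cut of a product falls in one of the factors
(`equidivisible`); a cut of a high power falls inside one copy of the base, with many copies on at
least one side (`exists_of_mul_eq_omegaPow`). Induction on the term concludes. -/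

open Filter Topology

/-! ### Aperiodicity of finite monoids as stabilization of powers -/

section Aperiodic

variable {M : Type*} [Monoid M]

theorem pow_eq_of_pow_eq_pow_succ {x : M} {n m : ℕ} (h : x ^ n = x ^ (n + 1)) (hm : n ≤ m) :
    x ^ m = x ^ n := by
  induction m, hm using Nat.le_induction with
  | base => rfl
  | succ k _ ih => rw [pow_succ, ih, ← pow_succ, ← h]

theorem isAperiodicMonoid_of_pow (h : ∀ x : M, ∃ n : ℕ, x ^ n = x ^ (n + 1)) :
    IsAperiodicMonoid M := by
  rintro S ⟨e, -, hid, hinv⟩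
  have key : ∀ x ∈ S, x = e := by
    intro x hx
    obtain ⟨y, -, -, hyx⟩ := hinv x hx
    obtain ⟨n, hn⟩ := h x
    have hcancel : ∀ k : ℕ, x ^ k * e = x ^ k * x → e = x := by
      intro k
      induction k with
      | zero => simp
      | succ k ih =>
        intro hk
        apply ih
        -- The identity `e` need not be `1`, so `x ^ 0` may lie outside `S`; cancelling down to
        -- exponent `0` needs its own argument.
        cases k with
        | zero =>
          rw [pow_one, (hid x hx).2] at hk
          have : y * x = y * x * x := by rw [mul_assoc, ← hk]
          rw [hyx, (hid x hx).1] at this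
          simpa using this
        | succ k =>
          have h1 : ∀ z, x ^ (k + 1 + 1) * z = x * (x * (x ^ k * z)) := fun z => by
            rw [pow_succ', pow_succ', mul_assoc, mul_assoc]
          have h2 : ∀ z, y * (x * (x * z)) = x * z := fun z => by
            rw [← mul_assoc, hyx, ← mul_assoc, (hid x hx).1]
          rw [h1, h1] at hk
          have := congrArg (y * ·) hk
          simp only [h2] at this
          rw [pow_succ', mul_assoc, mul_assoc, this]
    refine (hcancel (n + 1) ?_).symm
    rw [pow_succ, mul_assoc, mul_assoc, (hid x hx).2, ← pow_succ, ← mul_assoc, ← pow_succ,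
      ← pow_succ, pow_succ x (n + 1), ← hn, ← pow_succ, ← hn]
  intro x hx y hy
  rw [key x hx, key y hy]

/-- By pigeonhole the powers of `x` become periodic. The powers from `x ^ i` on form a group, which
must be trivial. Its identity is `x ^ (i * (p + 1))`, whose exponent is at least `i` and a multiple
of the period `p + 1`. -/
theorem IsAperiodicMonoid.exists_pow [Finite M] (h : IsAperiodicMonoid M) (x : M) :
    ∃ n : ℕ, x ^ n = x ^ (n + 1) := by
  obtain ⟨i, j, hij, hx⟩ : ∃ i j : ℕ, i < j ∧ x ^ i = x ^ j := by
    obtain ⟨i, j, hne, hx⟩ := Finite.exists_ne_map_eq_of_infinite (fun n : ℕ => x ^ n)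
    rcases lt_or_gt_of_ne hne with h | h
    exacts [⟨i, j, h, hx⟩, ⟨j, i, h, hx.symm⟩]
  obtain ⟨p, rfl⟩ : ∃ p, j = i + (p + 1) := ⟨j - i - 1, by omega⟩
  have step : ∀ k, i ≤ k → x ^ (k + (p + 1)) = x ^ k := by
    intro k hk
    obtain ⟨r, rfl⟩ := Nat.exists_eq_add_of_le hk
    rw [show i + r + (p + 1) = i + (p + 1) + r by omega, pow_add, ← hx, ← pow_add]
  have steps : ∀ m k, i ≤ k → x ^ (k + m * (p + 1)) = x ^ k := by
    intro m k hk
    induction m with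
    | zero => simp
    | succ m ih => rw [Nat.succ_mul, ← add_assoc, step _ (by omega), ih]
  have hle : i ≤ i * (p + 1) := Nat.le_mul_of_pos_right _ (by omega)
  let S : Subsemigroup M :=
    { carrier := {y | ∃ k, i ≤ k ∧ y = x ^ k}
      mul_mem' := by
        rintro _ _ ⟨k, hk, rfl⟩ ⟨l, -, rfl⟩
        exact ⟨k + l, by omega, (pow_add x k l).symm⟩ }
  have hS : IsGroupIn S := by
    refine ⟨x ^ (i * (p + 1)), ⟨_, hle, rfl⟩, ?_, ?_⟩
    · rintro _ ⟨k, hk, rfl⟩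
      exact ⟨by rw [← pow_add, add_comm, steps _ _ hk], by rw [← pow_add, steps _ _ hk]⟩
    · rintro _ ⟨k, hk, rfl⟩
      have e1 : x ^ (k + (i * (p + 1) + k * p)) = x ^ (i * (p + 1)) := by
        rw [show k + (i * (p + 1) + k * p) = i * (p + 1) + k * (p + 1) by ring, steps _ _ hle]
      refine ⟨x ^ (i * (p + 1) + k * p), ⟨_, by omega, rfl⟩, ?_, ?_⟩
      · rw [← pow_add, e1]
      · rw [← pow_add, add_comm, e1]
  exact ⟨i, h S hS ⟨i, le_rfl, rfl⟩ ⟨i + 1, by omega, rfl⟩⟩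

theorem IsAperiodicMonoid.exists_uniform_pow [Finite M] (h : IsAperiodicMonoid M) :
    ∃ N : ℕ, ∀ x : M, ∀ m, N ≤ m → x ^ m = x ^ N := by
  choose f hf using h.exists_pow
  obtain ⟨N, hN⟩ := (Set.finite_range f).bddAbove
  refine ⟨N, fun x m hm => ?_⟩
  have hx : f x ≤ N := hN ⟨x, rfl⟩
  rw [pow_eq_of_pow_eq_pow_succ (hf x) (hx.trans hm), pow_eq_of_pow_eq_pow_succ (hf x) hx]

end Aperiodic

/-! ### The directed system of congruences and cuts of words -/

namespace AperiodicCon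

variable {A : Type*}

/-- A congruence that is the kernel of a map to a finite type and satisfies `w ^ n ~ w ^ (n + 1)`
for large `n` has a finite aperiodic quotient. -/
def ofKer {α : Type*} [Finite α] (c : Con (FreeMonoid A)) (f : FreeMonoid A → α)
    (hf : ∀ x y, f x = f y → c x y) (hf' : ∀ x y, c x y → f x = f y)
    (hp : ∀ w, ∃ n : ℕ, c (w ^ n) (w ^ (n + 1))) : AperiodicCon A :=
  ⟨c, by
    refine Finite.of_injective (fun q : c.Quotient => Con.liftOn q f hf') ?_
    intro x y
    induction x using Con.induction_on
    induction y using Con.induction_on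
    exact fun h => (Con.eq c).2 (hf _ _ h), by
    refine isAperiodicMonoid_of_pow fun x => ?_
    induction x using Con.induction_on with
    | _ w =>
      obtain ⟨n, hn⟩ := hp w
      exact ⟨n, (Con.eq c).2 hn⟩⟩

variable (c : AperiodicCon A)

theorem proj_eq_iff {x y : FreeMonoid A} : c.proj x = c.proj y ↔ c.1 x y := Con.eq c.1

theorem proj_surjective : Function.Surjective c.proj := Con.mk'_surjective

theorem exists_stable : ∃ N : ℕ, ∀ x : c.Level, ∀ m, N ≤ m → x ^ m = x ^ N :=
  haveI : Finite c.1.Quotient := c.2.1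
  c.2.2.exists_uniform_pow

/-- An exponent from which on the powers of every element of the level are constant. -/
noncomputable def stab : ℕ := c.exists_stable.choose

theorem pow_stab (x : c.Level) {m : ℕ} (hm : c.stab ≤ m) : x ^ m = x ^ c.stab :=
  c.exists_stable.choose_spec x m hm

instance : Preorder (AperiodicCon A) := Preorder.lift (fun c => c.1)

/-- The common refinement of two congruences. -/
def inf (d : AperiodicCon A) : AperiodicCon A :=
  ofKer (c.1 ⊓ d.1) (fun w => (c.proj w, d.proj w))
    (fun _ _ h => ⟨c.proj_eq_iff.1 (Prod.ext_iff.1 h).1, d.proj_eq_iff.1 (Prod.ext_iff.1 h).2⟩)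
    (fun _ _ h => Prod.ext (c.proj_eq_iff.2 h.1) (d.proj_eq_iff.2 h.2))
    (fun w => ⟨c.stab + d.stab, by
      constructor
      · refine c.proj_eq_iff.1 ?_
        rw [map_pow, map_pow, c.pow_stab _ (m := c.stab + d.stab) (by omega),
          c.pow_stab _ (m := c.stab + d.stab + 1) (by omega)]
      · refine d.proj_eq_iff.1 ?_
        rw [map_pow, map_pow, d.pow_stab _ (m := c.stab + d.stab) (by omega),
          d.pow_stab _ (m := c.stab + d.stab + 1) (by omega)]⟩)

instance : IsCodirectedOrder (AperiodicCon A) :=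
  ⟨fun c d => ⟨c.inf d, (inf_le_left : c.1 ⊓ d.1 ≤ c.1), (inf_le_right : c.1 ⊓ d.1 ≤ d.1)⟩⟩

instance : Nonempty (AperiodicCon A) :=
  ⟨ofKer ⊤ (fun _ => ()) (fun _ _ _ => trivial) (fun _ _ _ => rfl) (fun _ => ⟨0, trivial⟩)⟩

/-- The images of all factorizations of a word. -/
def factors (w : FreeMonoid A) : Set (c.Level × c.Level) :=
  {z | ∃ p q : FreeMonoid A, p * q = w ∧ z = (c.proj p, c.proj q)}

end AperiodicCon

theorem FreeMonoid.mul_eq_mul_iff {A : Type*} {a b p q : FreeMonoid A} :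
    p * q = a * b ↔ (∃ r, a = p * r ∧ q = r * b) ∨ ∃ r, p = a * r ∧ b = r * q :=
  List.append_eq_append_iff

/-- The cut falls in one copy of `x`; the exponent `n + 1` guarantees that there is a copy to cut.
-/
theorem FreeMonoid.exists_of_mul_eq_pow {A : Type*} {x p q : FreeMonoid A} {n : ℕ}
    (h : p * q = x ^ (n + 1)) :
    ∃ (k l : ℕ) (y z : FreeMonoid A), k + l = n ∧ y * z = x ∧ p = x ^ k * y ∧ q = z * x ^ l := by
  induction n generalizing p with
  | zero => exact ⟨0, 0, p, q, rfl, by simpa using h, by simp, by simp⟩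
  | succ n ih =>
    rw [pow_succ', FreeMonoid.mul_eq_mul_iff] at h
    rcases h with ⟨r, hx, hq⟩ | ⟨r, hp, hq⟩
    · exact ⟨0, n + 1, p, r, by omega, hx.symm, by simp, hq⟩
    · obtain ⟨k, l, y, z, hkl, hyz, hr, hz⟩ := ih hq.symm
      exact ⟨k + 1, l, y, z, by omega, hyz, by rw [hp, hr, pow_succ', mul_assoc], hz⟩

/-! ### The congruence that records factorizations -/

namespace AperiodicCon

variable {A : Type*} (c : AperiodicCon A)

theorem proj_eq_of_factors_eq {x y : FreeMonoid A} (h : c.factors x = c.factors y) :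
    c.proj x = c.proj y := by
  have hx : (c.proj x, c.proj 1) ∈ c.factors y := h ▸ ⟨x, 1, mul_one x, rfl⟩
  obtain ⟨p, q, rfl, hz⟩ := hx
  rw [Prod.mk.injEq, map_one] at hz
  rw [map_mul, ← hz.1, ← hz.2, mul_one]

/-- A cut of `x * y` falls in `x` or in `y` and is transported there; the uncut factor keeps its
image. -/
theorem factors_mul_subset {x y x' y' : FreeMonoid A} (hx : c.factors x = c.factors x')
    (hy : c.factors y = c.factors y') : c.factors (x * y) ⊆ c.factors (x' * y') := by
  rintro _ ⟨p, q, hpq, rfl⟩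
  rcases FreeMonoid.mul_eq_mul_iff.1 hpq with ⟨r, ha, rfl⟩ | ⟨r, rfl, hb⟩
  · obtain ⟨p', r', rfl, hz⟩ : (c.proj p, c.proj r) ∈ c.factors x' := hx ▸ ⟨p, r, ha.symm, rfl⟩
    rw [Prod.mk.injEq] at hz
    refine ⟨p', r' * y', (mul_assoc _ _ _).symm, ?_⟩
    rw [map_mul, map_mul, hz.1, hz.2, c.proj_eq_of_factors_eq hy]
  · obtain ⟨r', q', rfl, hz⟩ : (c.proj r, c.proj q) ∈ c.factors y' := hy ▸ ⟨r, q, hb.symm, rfl⟩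
    rw [Prod.mk.injEq] at hz
    refine ⟨x' * r', q', mul_assoc _ _ _, ?_⟩
    rw [map_mul, map_mul, hz.1, hz.2, c.proj_eq_of_factors_eq hx]

/-- If the exponents are large, the powers of a word have the same factorizations. -/
theorem factors_pow_subset (w : FreeMonoid A) {m n : ℕ} (hm : 2 * c.stab ≤ m)
    (hn : 2 * c.stab ≤ n) : c.factors (w ^ (m + 1)) ⊆ c.factors (w ^ (n + 1)) := by
  rintro _ ⟨p, q, hpq, rfl⟩
  obtain ⟨k, l, y, z, hkl, hyz, rfl, rfl⟩ := FreeMonoid.exists_of_mul_eq_pow hpq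
  -- As `k + l = m ≥ 2 * c.stab`, one of `k`, `l` is in the stable range and can absorb the change
  -- of total to `n`. If both are, `k` is first lowered to `c.stab`.
  obtain ⟨k', l', hkl', hk, hl⟩ : ∃ k' l', k' + l' = n ∧
      c.proj w ^ k' = c.proj w ^ k ∧ c.proj w ^ l' = c.proj w ^ l := by
    rcases le_total c.stab k with h | h
    · rcases le_total c.stab l with h' | h'
      · exact ⟨c.stab, n - c.stab, by omega, (c.pow_stab _ h).symm,
          (c.pow_stab _ (by omega)).trans (c.pow_stab _ h').symm⟩
      · exact ⟨n - l, l, by omega, (c.pow_stab _ (by omega)).trans (c.pow_stab _ h).symm, rfl⟩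
    · exact ⟨k, n - k, by omega, rfl,
        (c.pow_stab _ (by omega)).trans (c.pow_stab _ (by omega)).symm⟩
  refine ⟨w ^ k' * y, z * w ^ l', ?_, ?_⟩
  · rw [← hkl', mul_assoc, ← mul_assoc y, hyz, ← pow_succ', ← pow_add, add_assoc]
  · simp only [map_mul, map_pow, hk, hl]

/-- The congruence identifying the words with the same images of factorizations. -/
def factorCon : AperiodicCon A :=
  ofKer
    { r := fun x y => c.factors x = c.factors y
      iseqv := ⟨fun _ => rfl, Eq.symm, Eq.trans⟩
      mul' := fun hx hy => (c.factors_mul_subset hx hy).antisymm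
        (c.factors_mul_subset hx.symm hy.symm) }
    c.factors (fun _ _ h => h) (fun _ _ h => h)
    (fun w => ⟨2 * c.stab + 1, (c.factors_pow_subset w le_rfl (by omega)).antisymm
      (c.factors_pow_subset w (by omega) le_rfl)⟩)

theorem factorCon_le : c.factorCon ≤ c := fun _ _ h =>
  c.proj_eq_iff.1 (c.proj_eq_of_factors_eq h)

theorem factors_eq_of_proj_eq {x y : FreeMonoid A} (h : c.factorCon.proj x = c.factorCon.proj y) :
    c.factors x = c.factors y := c.factorCon.proj_eq_iff.1 h

end AperiodicCon

/-! ### Coordinates of `ω`-powers -/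

namespace FreeProAperiodic

variable {A : Type*}

/-- The pseudoword given by a word. -/
def ofWord : FreeMonoid A →* FreeProAperiodic A where
  toFun w := ⟨fun c => c.proj w, fun _ _ _ => rfl⟩
  map_one' := ext_coord fun c => map_one c.proj
  map_mul' x y := ext_coord fun c => map_mul c.proj x y

theorem coord_ofWord (c : AperiodicCon A) (w : FreeMonoid A) : coord c (ofWord w) = c.proj w := rfl

theorem coord_eq_of_le {c d : AperiodicCon A} (h : c ≤ d) {x y : FreeProAperiodic A}
    (hxy : coord c x = coord c y) : coord d x = coord d y := by
  have hx : AperiodicCon.transition h (coord c x) = coord d x := x.2 c d h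
  have hy : AperiodicCon.transition h (coord c y) = coord d y := y.2 c d h
  rw [← hx, ← hy, hxy]

theorem coord_omegaPow (c : AperiodicCon A) (x : FreeProAperiodic A) {m : ℕ} (hm : c.stab ≤ m) :
    coord c (omegaPow x) = coord c x ^ m := by
  obtain ⟨hmem, hidem⟩ := (existsUnique_idempotent x).choose_spec.1
  obtain ⟨n, hn, h⟩ := coord_mem_powers hmem c
  have hid : coord c (omegaPow x) * coord c (omegaPow x) = coord c (omegaPow x) := by
    rw [← map_mul]; exact congrArg _ hidem
  -- Raising the idempotent to the power `c.stab + 1` pushes the unknown exponent `n > 0` into the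
  -- stable range.
  rw [c.pow_stab _ hm, ← pow_eq_of_mul_self hid (Nat.succ_pos c.stab),
    show coord c (omegaPow x) = coord c x ^ n from h, ← pow_mul]
  exact c.pow_stab _ (by nlinarith)

theorem omegaPow_mul_self (x : FreeProAperiodic A) : omegaPow x * x = omegaPow x :=
  ext_coord fun c => by
    rw [map_mul, coord_omegaPow c x le_rfl, ← pow_succ, c.pow_stab _ (Nat.le_succ _)]

theorem self_mul_omegaPow (x : FreeProAperiodic A) : x * omegaPow x = omegaPow x :=
  ext_coord fun c => by
    rw [map_mul, coord_omegaPow c x le_rfl, ← pow_succ', c.pow_stab _ (Nat.le_succ _)]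

theorem omegaPow_mul_omegaPow (x : FreeProAperiodic A) : omegaPow x * omegaPow x = omegaPow x :=
  (existsUnique_idempotent x).choose_spec.1.2

/-- The power of a pseudoword with a possibly infinite exponent. -/
noncomputable def expPow (x : FreeProAperiodic A) : OmegaExponent → FreeProAperiodic A
  | .nat n => x ^ n
  | .omega => omegaPow x

theorem expPow_zero (x : FreeProAperiodic A) : expPow x (.nat 0) = 1 := pow_zero x

theorem omegaPow_mul_expPow (x : FreeProAperiodic A) (l : OmegaExponent) :
    omegaPow x * expPow x l = omegaPow x := by
  cases l with
  | omega => exact omegaPow_mul_omegaPow x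
  | nat n =>
    induction n with
    | zero => rw [expPow_zero, mul_one]
    | succ n ih =>
      change omegaPow x * x ^ (n + 1) = _
      rw [pow_succ, ← mul_assoc, show omegaPow x * x ^ n = _ from ih, omegaPow_mul_self]

theorem expPow_mul_omegaPow (x : FreeProAperiodic A) (k : OmegaExponent) :
    expPow x k * omegaPow x = omegaPow x := by
  cases k with
  | omega => exact omegaPow_mul_omegaPow x
  | nat n =>
    induction n with
    | zero => rw [expPow_zero, one_mul]
    | succ n ih =>
      change x ^ (n + 1) * omegaPow x = _
      rw [pow_succ', mul_assoc, show x ^ n * omegaPow x = _ from ih, self_mul_omegaPow]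

/-! ### Limits along ever finer congruences, and openness of multiplication -/

/-- An ultrafilter of ever finer congruences. -/
noncomputable def fine (A : Type*) : Ultrafilter (AperiodicCon A) := Ultrafilter.of atBot

theorem eventually_fine_le (c : AperiodicCon A) : ∀ᶠ d in (fine A : Filter _), d ≤ c :=
  Ultrafilter.of_le _ (eventually_le_atBot c)

theorem exists_tendsto_fine (f : AperiodicCon A → FreeProAperiodic A) :
    ∃ x, Tendsto f (fine A) (𝓝 x) := by
  obtain ⟨x, -, hx⟩ := isCompact_univ.ultrafilter_le_nhds ((fine A).map f) (by simp)
  exact ⟨x, hx⟩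

theorem eventually_coord_eq {f : AperiodicCon A → FreeProAperiodic A} {x : FreeProAperiodic A}
    (hf : Tendsto f (fine A) (𝓝 x)) (c : AperiodicCon A) :
    ∀ᶠ d in (fine A : Filter _), coord c (f d) = coord c x := by
  have h := ((continuous_coord c).tendsto x).comp hf
  rw [nhds_discrete, tendsto_pure] at h
  exact h

theorem tendsto_fine_of_eventually {f : AperiodicCon A → FreeProAperiodic A}
    {x : FreeProAperiodic A}
    (hf : ∀ c, ∀ᶠ d in (fine A : Filter _), coord c (f d) = coord c x) :
    Tendsto f (fine A) (𝓝 x) := by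
  obtain ⟨y, hy⟩ := exists_tendsto_fine f
  have : y = x := ext_coord fun c => by
    obtain ⟨d, h1, h2⟩ := ((eventually_coord_eq hy c).and (hf c)).exists
    exact h1.symm.trans h2
  exact this ▸ hy

/-- The diagonal condition suffices: agreement at `d` passes to every coarser level `c`, and
eventually `d ≤ c`. -/
theorem tendsto_fine_of_coord_eq {f : AperiodicCon A → FreeProAperiodic A}
    {x : FreeProAperiodic A} (hf : ∀ᶠ c in (fine A : Filter _), coord c (f c) = coord c x) :
    Tendsto f (fine A) (𝓝 x) :=
  tendsto_fine_of_eventually fun c => by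
    filter_upwards [hf, eventually_fine_le c] with d h1 h2 using coord_eq_of_le h2 h1

/-- A word approximating `x` finely enough to control its factorizations at the level `c`. -/
noncomputable def approx (x : FreeProAperiodic A) (c : AperiodicCon A) : FreeMonoid A :=
  (c.factorCon.proj_surjective (coord c.factorCon x)).choose

theorem proj_approx (x : FreeProAperiodic A) (c : AperiodicCon A) :
    c.factorCon.proj (approx x c) = coord c.factorCon x :=
  (c.factorCon.proj_surjective (coord c.factorCon x)).choose_spec

theorem coord_approx (x : FreeProAperiodic A) (c : AperiodicCon A) :
    coord c (ofWord (approx x c)) = coord c x :=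
  coord_eq_of_le c.factorCon_le (proj_approx x c)

theorem tendsto_approx (x : FreeProAperiodic A) :
    Tendsto (fun c => ofWord (approx x c)) (fine A) (𝓝 x) :=
  tendsto_fine_of_coord_eq (Eventually.of_forall (coord_approx x))

/-- Multiplication of pseudowords is open: factorizations lift to approximating words. -/
theorem exists_factorization {u v : FreeProAperiodic A} {c : AperiodicCon A} {w : FreeMonoid A}
    (hw : c.factorCon.proj w = coord c.factorCon (u * v)) :
    ∃ p q : FreeMonoid A, p * q = w ∧ coord c (ofWord p) = coord c u ∧
      coord c (ofWord q) = coord c v := by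
  rw [map_mul, ← proj_approx u, ← proj_approx v, ← map_mul] at hw
  -- The word `approx u c * approx v c` has an obvious cut, and `w` has the same images of
  -- factorizations.
  obtain ⟨p, q, hpq, hz⟩ : (c.proj (approx u c), c.proj (approx v c)) ∈ c.factors w :=
    c.factors_eq_of_proj_eq hw ▸ ⟨_, _, rfl, rfl⟩
  rw [Prod.mk.injEq] at hz
  exact ⟨p, q, hpq, hz.1.symm.trans (coord_approx u c), hz.2.symm.trans (coord_approx v c)⟩

theorem exists_net_factorization {u v : FreeProAperiodic A} {w : AperiodicCon A → FreeMonoid A}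
    (hw : ∀ c : AperiodicCon A, c.factorCon.proj (w c) = coord c.factorCon (u * v)) :
    ∃ p q : AperiodicCon A → FreeMonoid A, (∀ c, p c * q c = w c) ∧
      Tendsto (fun c => ofWord (p c)) (fine A) (𝓝 u) ∧
      Tendsto (fun c => ofWord (q c)) (fine A) (𝓝 v) := by
  choose p q h hp hq using fun c => exists_factorization (hw c)
  exact ⟨p, q, h, tendsto_fine_of_coord_eq (Eventually.of_forall hp),
    tendsto_fine_of_coord_eq (Eventually.of_forall hq)⟩

/-! ### Factorizations of words, products and `ω`-powers -/

theorem ofWord_of (a : A) : ofWord (FreeMonoid.of a) = ofLetter a := rfl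

/-- A word has finitely many cuts, so the ultrafilter selects one of them and the approximating
factors are eventually constant. -/
theorem exists_word_factorization {u v : FreeProAperiodic A} {w : FreeMonoid A}
    (h : u * v = ofWord w) : ∃ p q : FreeMonoid A, p * q = w ∧ ofWord p = u ∧ ofWord q = v := by
  obtain ⟨p, q, hpq, hp, hq⟩ := exists_net_factorization (u := u) (v := v) (w := fun _ => w)
    (fun c => by rw [h, coord_ofWord])
  have hfin : {z : FreeMonoid A × FreeMonoid A | z.1 * z.2 = w}.Finite := by
    refine (Set.finite_range fun i : Fin (w.toList.length + 1) =>
      (FreeMonoid.ofList (w.toList.take i), FreeMonoid.ofList (w.toList.drop i))).subset ?_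
    rintro ⟨p, q⟩ rfl
    refine ⟨⟨p.toList.length, by simp⟩, ?_⟩
    simp
  obtain ⟨⟨p', q'⟩, hz, he⟩ := (Ultrafilter.eventually_exists_mem_iff hfin
    (f := fine A) (P := fun z c => (p c, q c) = z)).1
      (Eventually.of_forall fun c => ⟨_, hpq c, rfl⟩)
  refine ⟨p', q', hz, ?_, ?_⟩
  · refine tendsto_nhds_unique (tendsto_const_nhds.congr' ?_) hp
    filter_upwards [he] with c hc
    rw [(Prod.mk.inj hc).1]
  · refine tendsto_nhds_unique (tendsto_const_nhds.congr' ?_) hq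
    filter_upwards [he] with c hc
    rw [(Prod.mk.inj hc).2]

/-- The free pro-aperiodic monoid is equidivisible. -/
theorem equidivisible {x y u v : FreeProAperiodic A} (h : x * y = u * v) :
    (∃ r, u * r = x ∧ r * y = v) ∨ ∃ r, x * r = u ∧ r * v = y := by
  obtain ⟨p, q, hpq, hp, hq⟩ := exists_net_factorization (u := u) (v := v)
    (w := fun c => approx x c * approx y c)
    (fun c => by rw [map_mul, proj_approx, proj_approx, ← map_mul, h])
  have hx := tendsto_approx x
  have hy := tendsto_approx y
  have key : ∀ c, ∃ r, (approx x c = p c * r ∧ q c = r * approx y c) ∨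
      (p c = approx x c * r ∧ approx y c = r * q c) := fun c => by
    rcases FreeMonoid.mul_eq_mul_iff.1 (hpq c) with ⟨r, h⟩ | ⟨r, h⟩
    exacts [⟨r, Or.inl h⟩, ⟨r, Or.inr h⟩]
  choose r hr using key
  -- Compactness gives a limit of the overlaps `r c`; the ultrafilter decides on which side of the
  -- cut they lie.
  obtain ⟨s, hs⟩ := exists_tendsto_fine fun c => ofWord (r c)
  rcases Ultrafilter.eventually_or.1 (Eventually.of_forall (f := (fine A : Filter _)) hr)
    with hr | hr
  · refine Or.inl ⟨s, tendsto_nhds_unique ((hp.mul hs).congr' ?_) hx,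
      tendsto_nhds_unique ((hs.mul hy).congr' ?_) hq⟩
    · filter_upwards [hr] with c hc
      rw [hc.1, map_mul]
    · filter_upwards [hr] with c hc
      rw [hc.2, map_mul]
  · refine Or.inr ⟨s, tendsto_nhds_unique ((hx.mul hs).congr' ?_) hp,
      tendsto_nhds_unique ((hs.mul hq).congr' ?_) hy⟩
    · filter_upwards [hr] with c hc
      rw [hc.1, map_mul]
    · filter_upwards [hr] with c hc
      rw [hc.2, map_mul]

theorem tendsto_pow_of_stab_le {f : AperiodicCon A → FreeProAperiodic A}
    {x : FreeProAperiodic A}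
    (hf : ∀ c, coord c (f c) = coord c x) {k : AperiodicCon A → ℕ}
    (hk : ∀ᶠ c in (fine A : Filter _), c.stab ≤ k c) :
    Tendsto (fun c => f c ^ k c) (fine A) (𝓝 (omegaPow x)) :=
  tendsto_fine_of_coord_eq (by
    filter_upwards [hk] with c hc
    rw [map_pow, hf, coord_omegaPow c x hc])

/-- Along the ultrafilter, `k` is either bounded, hence eventually constant, or eventually beyond
every bound, hence beyond each `c.stab`. -/
theorem exists_tendsto_pow {f : AperiodicCon A → FreeProAperiodic A} {x : FreeProAperiodic A}
    (hf : Tendsto f (fine A) (𝓝 x)) (k : AperiodicCon A → ℕ) :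
    ∃ K, Tendsto (fun c => f c ^ k c) (fine A) (𝓝 (expPow x K)) := by
  by_cases h : ∃ n, ∀ᶠ c in (fine A : Filter _), k c < n
  · obtain ⟨n, hn⟩ := h
    obtain ⟨m, -, hm⟩ := (Ultrafilter.eventually_exists_mem_iff (Set.finite_Iio n)
      (f := fine A) (P := fun m c => k c = m)).1 (hn.mono fun c hc => ⟨k c, hc, rfl⟩)
    refine ⟨.nat m, (hf.pow m).congr' ?_⟩
    filter_upwards [hm] with c hc
    rw [hc]
  · refine ⟨.omega, tendsto_fine_of_eventually fun c => ?_⟩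
    have hc : ∀ᶠ d in (fine A : Filter _), ¬ k d < c.stab :=
      Ultrafilter.eventually_not.2 fun h' => h ⟨_, h'⟩
    filter_upwards [hc, eventually_coord_eq hf c] with d h1 h2
    rw [map_pow, h2]
    exact (coord_omegaPow c x (not_lt.1 h1)).symm

/-- The factorizations of an `ω`-power. -/
theorem exists_of_mul_eq_omegaPow {x u v : FreeProAperiodic A} (h : u * v = omegaPow x) :
    ∃ (k l : OmegaExponent) (y z : FreeProAperiodic A),
      (k = OmegaExponent.omega ∨ l = OmegaExponent.omega) ∧ y * z = x ∧
        expPow x k * y = u ∧ z * expPow x l = v := by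
  obtain ⟨p, q, hpq, hp, hq⟩ := exists_net_factorization (u := u) (v := v)
    -- The term `c.factorCon.stab` makes this power agree with `omegaPow x` at `c.factorCon`; the
    -- term `2 * c.stab` forces one side of the cut to have at least `c.stab` full copies.
    (w := fun c => approx x c ^ (c.factorCon.stab + 2 * c.stab + 1))
    (fun c => by rw [map_pow, proj_approx, h,
      coord_omegaPow _ _ (m := c.factorCon.stab + 2 * c.stab + 1) (by omega)])
  choose k l y z hkl hyz hpk hql using fun c => FreeMonoid.exists_of_mul_eq_pow (hpq c)
  obtain ⟨y', hy⟩ := exists_tendsto_fine fun c => ofWord (y c)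
  obtain ⟨z', hz⟩ := exists_tendsto_fine fun c => ofWord (z c)
  have hx := tendsto_approx x
  obtain ⟨K, L, hKL, hK, hL⟩ : ∃ K L, (K = OmegaExponent.omega ∨ L = OmegaExponent.omega) ∧
      Tendsto (fun c => ofWord (approx x c) ^ k c) (fine A) (𝓝 (expPow x K)) ∧
      Tendsto (fun c => ofWord (approx x c) ^ l c) (fine A) (𝓝 (expPow x L)) := by
    obtain ⟨K, hK⟩ := exists_tendsto_pow hx k
    obtain ⟨L, hL⟩ := exists_tendsto_pow hx l
    have hor : ∀ᶠ c in (fine A : Filter _), c.stab ≤ k c ∨ c.stab ≤ l c :=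
      Eventually.of_forall fun c => by have := hkl c; omega
    rcases Ultrafilter.eventually_or.1 hor with h' | h'
    · exact ⟨.omega, L, Or.inl rfl, tendsto_pow_of_stab_le (coord_approx x) h', hL⟩
    · exact ⟨K, .omega, Or.inr rfl, hK, tendsto_pow_of_stab_le (coord_approx x) h'⟩
  refine ⟨K, L, y', z', hKL, tendsto_nhds_unique ((hy.mul hz).congr fun c => ?_) hx,
    tendsto_nhds_unique ((hK.mul hy).congr fun c => ?_) hp,
    tendsto_nhds_unique ((hz.mul hL).congr fun c => ?_) hq⟩
  · rw [← map_mul, hyz]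
  · rw [hpk, map_mul, map_pow]
  · rw [hql, map_mul, map_pow]

end FreeProAperiodic

/-! ### Decompositions of terms -/

namespace OmegaTerm

open FreeProAperiodic

variable {A : Type*}

theorem eval_powSucc (s : OmegaTerm A) (n : ℕ) : (s.powSucc n).eval = s.eval ^ (n + 1) := by
  induction n with
  | zero => simp [powSucc]
  | succ n ih => rw [powSucc, eval, ih, ← pow_succ]

theorem eval_powMul (s t : OmegaTerm A) (k : OmegaExponent) :
    (powMul s k t).eval = expPow s.eval k * t.eval := by
  rcases k with (_ | n) | _
  · rw [expPow_zero, one_mul, powMul]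
  · exact congrArg (· * _) (eval_powSucc s n)
  · rfl

theorem eval_mulPow (s t : OmegaTerm A) (l : OmegaExponent) :
    (mulPow t s l).eval = t.eval * expPow s.eval l := by
  rcases l with (_ | n) | _
  · rw [expPow_zero, mul_one, mulPow]
  · exact congrArg (_ * ·) (eval_powSucc s n)
  · rfl

theorem IsDecomposition.eval_mul_eval {t t₁ t₂ : OmegaTerm A} (h : t.IsDecomposition t₁ t₂) :
    t₁.eval * t₂.eval = t.eval := by
  induction h with
  | one => exact one_mul _
  | letter_right a => exact one_mul _
  | letter_left a => exact mul_one _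
  | mul_left _ ih => rw [eval, eval, ← mul_assoc, ih]
  | mul_right _ ih => rw [eval, eval, mul_assoc, ih]
  | @omega s s₁ s₂ k l hkl _ ih =>
    rw [eval_powMul, eval_mulPow, mul_assoc, ← mul_assoc s₁.eval, ih, eval]
    -- The side with exponent `ω` absorbs the reassembled copy of `s`, then the power on the other
    -- side.
    rcases hkl with rfl | rfl
    · rw [← mul_assoc, show expPow s.eval .omega * s.eval = _ from omegaPow_mul_self _]
      exact omegaPow_mul_expPow _ _
    · rw [show s.eval * expPow s.eval .omega = _ from self_mul_omegaPow _]
      exact expPow_mul_omegaPow _ _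

theorem exists_isDecomposition (t : OmegaTerm A) {u v : FreeProAperiodic A}
    (h : u * v = t.eval) :
    ∃ t₁ t₂ : OmegaTerm A, t.IsDecomposition t₁ t₂ ∧ t₁.eval = u ∧ t₂.eval = v := by
  induction t generalizing u v with
  | one =>
    obtain ⟨p, q, hpq, rfl, rfl⟩ := exists_word_factorization (h.trans (map_one ofWord).symm)
    obtain ⟨rfl, rfl⟩ : p = 1 ∧ q = 1 := List.append_eq_nil_iff.1 hpq
    exact ⟨_, _, .one, (map_one ofWord).symm, (map_one ofWord).symm⟩
  | letter a =>
    obtain ⟨p, q, hpq, rfl, rfl⟩ := exists_word_factorization (h.trans (ofWord_of a).symm)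
    rcases List.append_eq_singleton_iff.1 hpq with ⟨hp, hq⟩ | ⟨hp, hq⟩
    · obtain rfl : p = 1 := hp
      obtain rfl : q = FreeMonoid.of a := hq
      exact ⟨_, _, .letter_right a, (map_one ofWord).symm, rfl⟩
    · obtain rfl : p = FreeMonoid.of a := hp
      obtain rfl : q = 1 := hq
      exact ⟨_, _, .letter_left a, rfl, (map_one ofWord).symm⟩
  | mul s t ihs iht =>
    rcases equidivisible h.symm with ⟨r, h1, h2⟩ | ⟨r, h1, h2⟩
    · obtain ⟨s₁, s₂, hd, rfl, rfl⟩ := ihs h1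
      exact ⟨_, _, hd.mul_left, rfl, h2⟩
    · obtain ⟨t₁, t₂, hd, rfl, rfl⟩ := iht h2
      exact ⟨_, _, hd.mul_right, h1, rfl⟩
  | omega s ih =>
    obtain ⟨k, l, y, z, hkl, hyz, rfl, rfl⟩ := exists_of_mul_eq_omegaPow h
    obtain ⟨s₁, s₂, hd, rfl, rfl⟩ := ih hyz
    exact ⟨_, _, .omega k l hkl hd, eval_powMul _ _ _, eval_mulPow _ _ _⟩

theorem exists_represents {w : FreeProAperiodic A} (hw : w.IsOmegaWord) :
    ∃ t : OmegaTerm A, t.Represents w := by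
  induction hw with
  | letter a => exact ⟨letter a, rfl⟩
  | one => exact ⟨one, rfl⟩
  | mul _ _ ihx ihy =>
    obtain ⟨s, rfl⟩ := ihx
    obtain ⟨t, rfl⟩ := ihy
    exact ⟨mul s t, rfl⟩
  | omega _ ih =>
    obtain ⟨s, rfl⟩ := ih
    exact ⟨omega s, rfl⟩

end OmegaTerm

theorem mainTheorem7 {A : Type*} [Finite A] :
    (∀ (t : OmegaTerm A) (u v : FreeProAperiodic A),
      t.Represents (u * v) ↔
        ∃ t₁ t₂ : OmegaTerm A, t.IsDecomposition t₁ t₂ ∧ t₁.Represents u ∧ t₂.Represents v) ∧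
    (∀ w : FreeProAperiodic A, w.IsOmegaWord →
      (∃ t : OmegaTerm A, t.Represents w) ∧
      ∀ t : OmegaTerm A, t.Represents w → ∀ u v : FreeProAperiodic A, u * v = w →
        ∃ t₁ t₂ : OmegaTerm A, t.IsDecomposition t₁ t₂ ∧ t₁.Represents u ∧ t₂.Represents v) := by
  refine ⟨fun t u v => ⟨fun h => t.exists_isDecomposition h.symm, ?_⟩,
    fun w hw => ⟨OmegaTerm.exists_represents hw, ?_⟩⟩
  · rintro ⟨t₁, t₂, hd, rfl, rfl⟩
    exact hd.eval_mul_eval.symm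
  · rintro t rfl u v h
    exact t.exists_isDecomposition h
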